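/- **Setting.** Let $R^f=\mathbb Z[A^{\pm1}]$, $z=-A^2-A^{-2}\in R^f$, and $R^a=\mathbb Z[A^{\pm1},z_1,z_2,\dots]\supset R^f$, with $z_0:=z$. Let $n\ge 1$, and order $V_n=\{0,1\}\times\{1,\dots,n\}$ by $(0,1)<\dots<(0,n)<(1,n)<\dots<(1,1)$. A *flat virtual $n$-tangle* is a partition $E$ of $V_n$ into pairs (arcs). An *arrow flat $n$-tangle* is a pair $F=(E,f)$ with $f:E\to\mathbb Z$ such that $f(\{(a,b),(c,d)\})$ is odd if $a=c$ and even if $a\ne c$. The parity of an arc $\{(a,b),(c,d)\}$ is $-1$ if $a=c$ and $1$ if $a\neq c$. If arcs $\gamma_1,\dots,\gamma_\ell$ are run along one after the other, the value of this walk is $\sum_i\varpi_i f(\gamma_i)$, where $\varpi_i$ is the product of the parities of $\gamma_1,\dots,\gamma_{i-1}$ if $\gamma_i$ is run from its smaller to its larger end, and of $\gamma_1,\dots,\gamma_i$ otherwise. If a closed curve has value $h$, its number of zigzags is $\zeta=|h|/2$; here the curves of a concatenation (see below) are run starting from the point $(1,b)$ of the first tangle, and the curves of a closure starting from $(0,b)$,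 where $b$ is the smallest column that the curve meets (at the interface, in the case of a concatenation). Given $E,E'$, glue each point $(1,b)$ of $E$ to the point $(0,b)$ of $E'$. This gives $n$ arcs, which form a flat virtual tangle $E*E'$, and some number $m$ of closed curves. $\mathrm{VTL}_n(R^f)$ is the free $R^f$-module on the flat virtual $n$-tangles with the bilinear product $E\,E'=z^m(E*E')$. Given $F=(E,f)$ and $F'=(E',f')$, label each arc of $E*E'$ by its value, run from its smaller end; this gives $F*F'$. $\mathrm{ATL}_n(R^a)$ is the free $R^a$-module on the arrow flat $n$-tangles with the bilinear product $F\,F'=z_{\zeta(\gamma_1)}\cdots z_{\zeta(\gamma_m)}(F*F')$, where $\gamma_1,\dots,\gamma_m$ are the closed curves. The unit of either algebra is the tangle with arcs $\{(0,b),(1,b)\}$, in the arrow case with all labels $0$. For $1\le i\le n-1$ let $E_i$ be the flat tangle with arcs $\{(0,i),(0,i+1)\}$, $\{(1,i),(1,i+1)\}$, and $\{(0,b),(1,b)\}$ for $b\ne i,i+1$. Let $F_i$ be $E_i$ with label $1$ on the first two arcs and $0$ on the others. The closure of $E$ is obtained by joining $(0,b)$ to $(1,b)$ for all $b$. If it consists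 of closed curves $\gamma_1,\dots,\gamma_t$, set $T_n'^f(E)=z^t$ and, for $F=(E,f)$, $T_n'^a(F)=z_{\zeta(\gamma_1)}\cdots z_{\zeta(\gamma_t)}$. Extend these linearly to $T_n'^f:\mathrm{VTL}_n(R^f)\to R^f$ and $T_n'^a:\mathrm{ATL}_n(R^a)\to R^a$. Let $\mathrm{TL}_n(R^f)$ be the unital associative $R^f$-algebra with generators $E_1,\dots,E_{n-1}$ and relations $E_i^2=zE_i$; $E_iE_j=E_jE_i$ for $|i-j|\ge2$; $E_iE_jE_i=E_i$ for $|i-j|=1$. **Proposition 3.7.** Let $n\ge1$. There are a unique $R^f$-linear, multiplicative and unital map $\varepsilon_n:\mathrm{TL}_n(R^f)\to\mathrm{VTL}_n(R^f)$ with $\varepsilon_n(E_i)=E_i$ for all $i$, and a unique $R^f$-linear, multiplicative and unital map $\iota_n:\mathrm{TL}_n(R^f)\to\mathrm{ATL}_n(R^a)$ with $\iota_n(E_i)=F_i$ for all $i$. For every $x\in\mathrm{TL}_n(R^f)$, $$T_n'^a(\iota_n(x))=T_n'^f(\varepsilon_n(x))\in R^f\subset R^a .$$ -/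

import Mathlib

open Finset

/-! ### Coefficient rings -/

/-- The ring `R^f = ℤ[A^{±1}]`; the variable `A` is `LaurentPolynomial.T 1`. -/
abbrev Rf : Type := LaurentPolynomial ℤ

/-- The ring `R^a = ℤ[A^{±1}, z₁, z₂, …]`. -/
abbrev Ra : Type := MvPolynomial ℕ+ Rf

/-- The loop value `z = -A² - A⁻²` in `R^f`. -/
noncomputable def loopValue : Rf := -LaurentPolynomial.T 2 - LaurentPolynomial.T (-2)

/-- The family `z₀, z₁, z₂, …` in `R^a`, with `z₀ = -A² - A⁻²` and `z_k` a variable for `k ≥ 1`. -/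
noncomputable def arrowVar : ℕ → Ra
  | 0 => MvPolynomial.C loopValue
  | k + 1 => MvPolynomial.X k.succPNat

/-! ### Flat virtual tangles -/

/-- The set `V_n = {0,1} × {1,…,n}`; `false` is the side `0`, `true` is the side `1`. -/
abbrev Vtx (n : ℕ) : Type := Bool × Fin n

/-- The point in the same column on the opposite side. -/
def Vtx.opp {n : ℕ} (v : Vtx n) : Vtx n := (!v.1, v.2)

/-- The strict total order `(0,1) < (0,2) < ⋯ < (0,n) < (1,n) < ⋯ < (1,2) < (1,1)` on `V_n`. -/
def Vtx.Before {n : ℕ} (u v : Vtx n) : Prop :=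
  (u.1 = false ∧ v.1 = true) ∨ (u.1 = false ∧ v.1 = false ∧ u.2 < v.2) ∨
    (u.1 = true ∧ v.1 = true ∧ v.2 < u.2)

instance {n : ℕ} (u v : Vtx n) : Decidable (Vtx.Before u v) :=
  inferInstanceAs (Decidable (_ ∨ _))

theorem Vtx.before_trichotomy {n : ℕ} (u v : Vtx n) (h : u ≠ v) :
    Vtx.Before v u ↔ ¬ Vtx.Before u v := by
  obtain ⟨a, b⟩ := u
  obtain ⟨c, d⟩ := v
  cases a <;> cases c <;> simp_all [Vtx.Before] <;> omega

theorem Vtx.opp_opp {n : ℕ} (v : Vtx n) : v.opp.opp = v := by simp [Vtx.opp]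

/-- A flat virtual `n`-tangle: a partition of `V_n` into pairs, given by the fixed-point-free
involution that exchanges the two members of each pair. -/
@[ext] structure FlatTangle (n : ℕ) where
  partner : Vtx n → Vtx n
  partner_partner : ∀ v, partner (partner v) = v
  partner_ne : ∀ v, partner v ≠ v

namespace FlatTangle

variable {n : ℕ}

/-! Concatenation.  A point of `E ⊔ E'` is a pair `(t, v)`, where `t` is `false` for an endpoint of
an arc of `E` and `true` for an endpoint of an arc of `E'`.  The endpoint `(1,b)` of `E` is glued to
the endpoint `(0,b)` of `E'`; the remaining endpoints are the exterior ones. -/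

/-- The other end, in `E ⊔ E'`, of the arc that ends in the given point. -/
def glueMate (E E' : FlatTangle n) (p : Bool × Vtx n) : Bool × Vtx n :=
  (p.1, (if p.1 then E' else E).partner p.2)

/-- The other point in the same column (for interface points, the point they are glued to). -/
def glueCross (p : Bool × Vtx n) : Bool × Vtx n := (!p.1, p.2.opp)

/-- A point of `E ⊔ E'` is exterior if it is on side `0` of `E` or on side `1` of `E'`. -/
def Exterior (p : Bool × Vtx n) : Prop := p.2.1 = p.1

instance (p : Bool × Vtx n) : Decidable (Exterior p) := inferInstanceAs (Decidable (_ = _))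

/-- One step of a walk through `E ⊔ E'`: run along the arc that starts in the given point, then move
to the point glued to its end, where the next arc starts.  (The steps that follow the arrival in an
exterior point are never used.) -/
def glueStep (E E' : FlatTangle n) (p : Bool × Vtx n) : Bool × Vtx n :=
  glueCross (glueMate E E' p)

theorem glueMate_glueMate (E E' : FlatTangle n) (p : Bool × Vtx n) :
    glueMate E E' (glueMate E E' p) = p := by
  obtain ⟨t, v⟩ := p
  cases t <;> simp [glueMate, partner_partner]

theorem glueMate_ne (E E' : FlatTangle n) (p : Bool × Vtx n) : glueMate E E' p ≠ p := by
  obtain ⟨t, v⟩ := p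
  cases t <;> simp [glueMate, partner_ne]

theorem glueCross_glueCross (p : Bool × Vtx n) : glueCross (glueCross p) = p := by
  simp [glueCross, Vtx.opp]

theorem glueCross_ne (p : Bool × Vtx n) : glueCross p ≠ p := by
  obtain ⟨t, v⟩ := p
  cases t <;> simp [glueCross]

theorem exterior_glueCross (p : Bool × Vtx n) : Exterior (glueCross p) ↔ Exterior p := by
  obtain ⟨t, a, b⟩ := p
  cases t <;> cases a <;> simp [Exterior, glueCross, Vtx.opp]

theorem exterior_start (u : Vtx n) : Exterior (u.1, u) := rfl

theorem start_of_exterior {p : Bool × Vtx n} (h : Exterior p) : (p.2.1, p.2) = p := by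
  rw [Exterior] at h
  rw [h]

theorem glueStep_injective (E E' : FlatTangle n) : Function.Injective (glueStep E E') := by
  intro p q h
  have h1 := congrArg glueCross h
  simp only [glueStep, glueCross_glueCross] at h1
  have h2 := congrArg (glueMate E E') h1
  simpa only [glueMate_glueMate] using h2

/-- The walk that starts in an exterior point arrives in an exterior point. -/
theorem exists_exit (E E' : FlatTangle n) (u : Vtx n) :
    ∃ k, Exterior (glueMate E E' ((glueStep E E')^[k] (u.1, u))) := by
  obtain ⟨k, hk, hper⟩ := (glueStep_injective E E').mem_periodicPts (u.1, u)
  obtain ⟨m, rfl⟩ : ∃ m, k = m + 1 := ⟨k - 1, by omega⟩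
  refine ⟨m, ?_⟩
  rw [← exterior_glueCross]
  have h : glueCross (glueMate E E' ((glueStep E E')^[m] (u.1, u))) = (u.1, u) := by
    have h' : (glueStep E E')^[m + 1] (u.1, u) = (u.1, u) := hper
    rw [Function.iterate_succ_apply'] at h'
    exact h'
  rw [h]
  exact exterior_start u

/-- The arc of `E ⊔ E'` that starts in the exterior point `u` has length `exitTime E E' u + 1`. -/
def exitTime (E E' : FlatTangle n) (u : Vtx n) : ℕ := Nat.find (exists_exit E E' u)

/-- The other end of the arc of `E ⊔ E'` that starts in the exterior point `u`. -/
def concatPartner (E E' : FlatTangle n) (u : Vtx n) : Vtx n :=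
  (glueMate E E' ((glueStep E E')^[exitTime E E' u] (u.1, u))).2

theorem concat_end (E E' : FlatTangle n) (u : Vtx n) :
    ((concatPartner E E' u).1, concatPartner E E' u) =
      glueMate E E' ((glueStep E E')^[exitTime E E' u] (u.1, u)) :=
  start_of_exterior (Nat.find_spec (exists_exit E E' u))

/-- Walking back from the end of an arc. -/
theorem concat_back (E E' : FlatTangle n) (u : Vtx n) (j : ℕ) (hj : j ≤ exitTime E E' u) :
    (glueStep E E')^[j] ((concatPartner E E' u).1, concatPartner E E' u) =
      glueMate E E' ((glueStep E E')^[exitTime E E' u - j] (u.1, u)) := by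
  induction j with
  | zero => simpa using concat_end E E' u
  | succ j ih =>
    rw [Function.iterate_succ_apply', ih (by omega)]
    obtain ⟨m, hm⟩ : ∃ m, exitTime E E' u - j = m + 1 := ⟨exitTime E E' u - j - 1, by omega⟩
    have hm' : exitTime E E' u - (j + 1) = m := by omega
    rw [hm, hm', Function.iterate_succ_apply']
    simp only [glueStep, glueMate_glueMate, glueCross_glueCross]

theorem exitTime_concatPartner (E E' : FlatTangle n) (u : Vtx n) :
    exitTime E E' (concatPartner E E' u) = exitTime E E' u := by
  refine (Nat.find_eq_iff _).2 ⟨?_, ?_⟩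
  · rw [concat_back E E' u _ le_rfl, glueMate_glueMate]
    simpa using exterior_start u
  · intro j hj
    rw [concat_back E E' u j hj.le, glueMate_glueMate]
    obtain ⟨m, hm⟩ : ∃ m, exitTime E E' u - j = m + 1 := ⟨exitTime E E' u - j - 1, by omega⟩
    rw [hm, Function.iterate_succ_apply', glueStep, exterior_glueCross]
    exact Nat.find_min (exists_exit E E' u) (show m < exitTime E E' u by omega)

/-- The tangle `E * E'`, formed by the boundaries of the arcs of `E ⊔ E'`. -/
def concat (E E' : FlatTangle n) : FlatTangle n where
  partner := concatPartner E E'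
  partner_partner u := by
    have h : concatPartner E E' (concatPartner E E' u) = (u.1, u).2 := by
      conv_lhs => rw [concatPartner]
      rw [exitTime_concatPartner, concat_back E E' u _ le_rfl, glueMate_glueMate]
      simp
    exact h
  partner_ne u hu := by
    have key : ∀ j ≤ exitTime E E' u, (glueStep E E')^[j] (u.1, u) =
        glueMate E E' ((glueStep E E')^[exitTime E E' u - j] (u.1, u)) := by
      intro j hj
      have h := concat_back E E' u j hj
      rwa [hu] at h
    obtain ⟨m, hm | hm⟩ : ∃ m, exitTime E E' u = 2 * m ∨ exitTime E E' u = 2 * m + 1 :=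
      ⟨exitTime E E' u / 2, by omega⟩
    · have h := key m (by omega)
      rw [show exitTime E E' u - m = m by omega] at h
      exact glueMate_ne _ _ _ h.symm
    · have h := key (m + 1) (by omega)
      rw [show exitTime E E' u - (m + 1) = m by omega, Function.iterate_succ_apply'] at h
      exact glueCross_ne _ h

/-- The cycles of `E ⊔ E'`, each recorded by the smallest column `b₀` that it meets at the
interface.  The cycle starts in the endpoint `(1, b₀)` of `E`, it never arrives in an exterior
point, and all of its columns are at least `b₀`. -/
noncomputable def glueCycles (E E' : FlatTangle n) : Finset (Fin n) := by
  classical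
  exact univ.filter fun b => ∀ i : ℕ,
    ¬ Exterior (glueMate E E' ((glueStep E E')^[i] (false, (true, b)))) ∧
      b ≤ ((glueStep E E')^[i] (false, (true, b))).2.2

/-- The length of the cycle of `E ⊔ E'` through the endpoint `(1,b)` of `E`. -/
noncomputable def glueCycleLength (E E' : FlatTangle n) (b : Fin n) : ℕ :=
  Function.minimalPeriod (glueStep E E') (false, (true, b))

/-! Closure: the point `(0,b)` is joined to the point `(1,b)`, for all `b`. -/

/-- One step of a walk through the closure of `E`: run along the arc that starts in the given point,
then move to the point of the same column on the opposite side. -/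
def closureStep (E : FlatTangle n) (v : Vtx n) : Vtx n := (E.partner v).opp

/-- The cycles (closed curves) of the closure of `E`, each recorded by the smallest column `b₀` that
it meets.  The cycle starts in `(0, b₀)`. -/
noncomputable def closureCycles (E : FlatTangle n) : Finset (Fin n) := by
  classical
  exact univ.filter fun b => ∀ i : ℕ, b ≤ (E.closureStep^[i] (false, b)).2

/-- The number of arcs on the closed curve of the closure of `E` that runs through `(0,b)`. -/
noncomputable def closureCycleLength (E : FlatTangle n) (b : Fin n) : ℕ :=
  Function.minimalPeriod E.closureStep (false, b)

/-- The identity tangle, with arcs `{(0,b),(1,b)}`. -/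
def identity (n : ℕ) : FlatTangle n where
  partner := Vtx.opp
  partner_partner := Vtx.opp_opp
  partner_ne v := by
    obtain ⟨a, b⟩ := v
    cases a <;> simp [Vtx.opp]

/-- The column of the point `i` (respectively `i+1`) for the `i`-th generator. -/
def leftCol (i : Fin (n - 1)) : Fin n := ⟨i, by omega⟩

/-- See `leftCol`. -/
def rightCol (i : Fin (n - 1)) : Fin n := ⟨i + 1, by omega⟩

/-- The tangle `E_i`, with arcs `{(0,i),(0,i+1)}`, `{(1,i),(1,i+1)}`, and `{(0,b),(1,b)}` for
`b ≠ i, i+1`. -/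
def cupCap (i : Fin (n - 1)) : FlatTangle n where
  partner v :=
    if v.2 = leftCol i then (v.1, rightCol i)
    else if v.2 = rightCol i then (v.1, leftCol i)
    else v.opp
  partner_partner v := by
    have h : rightCol i ≠ leftCol i := by simp [leftCol, rightCol]
    obtain ⟨a, b⟩ := v
    by_cases h1 : b = leftCol i
    · simp [h1, h]
    · by_cases h2 : b = rightCol i
      · simp [h2, h]
      · simp [h1, h2, Vtx.opp]
  partner_ne v := by
    have h : rightCol i ≠ leftCol i := by simp [leftCol, rightCol]
    obtain ⟨a, b⟩ := v
    by_cases h1 : b = leftCol i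
    · simp [h1, h]
    · by_cases h2 : b = rightCol i
      · simp [h2, h, h.symm]
      · simp [h1, h2, Vtx.opp]

end FlatTangle

/-! ### Arrow flat tangles -/

/-- An arrow flat `n`-tangle: a flat virtual `n`-tangle whose arcs are labelled by integers; the
label of an arc is odd if its ends are on the same side, and even otherwise.  Here `label v` is the
label of the arc that ends in `v`. -/
@[ext] structure ArrowTangle (n : ℕ) extends FlatTangle n where
  label : Vtx n → ℤ
  label_partner : ∀ v, label (partner v) = label v
  odd_label_iff : ∀ v, Odd (label v) ↔ (partner v).1 = v.1

/-- For a walk `s, step s, step² s, …` along arcs with parities `par` and oriented labels `val`, the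
sum of the oriented labels of the first `ℓ` arcs, each multiplied by the product of the parities of
the arcs before it. -/
def walkSum {S : Type} (step : S → S) (par val : S → ℤ) (s : S) (ℓ : ℕ) : ℤ :=
  ∑ i ∈ range ℓ, (∏ j ∈ range i, par (step^[j] s)) * val (step^[i] s)

namespace ArrowTangle

variable {n : ℕ}

/-- The parity of the arc that ends in `v`. -/
def parity (F : ArrowTangle n) (v : Vtx n) : ℤ := if (F.partner v).1 = v.1 then -1 else 1

/-- The label of the arc that ends in `v` when it is run along starting from `v`: the label itself
if `v` is the smaller end, and the label times the parity if `v` is the larger end.  Thus the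
oriented label times the product of the parities of the preceding arcs is the label times the
cumulated parity. -/
def orientedLabel (F : ArrowTangle n) (v : Vtx n) : ℤ :=
  if Vtx.Before v (F.partner v) then F.label v else F.parity v * F.label v

/-- Parities in `E ⊔ E'`. -/
def glueParity (F F' : ArrowTangle n) (p : Bool × Vtx n) : ℤ := (if p.1 then F' else F).parity p.2

/-- Oriented labels in `E ⊔ E'`. -/
def glueLabel (F F' : ArrowTangle n) (p : Bool × Vtx n) : ℤ :=
  (if p.1 then F' else F).orientedLabel p.2

/-- The value along the first `ℓ` arcs of the walk in `E ⊔ E'` that starts in `p`. -/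
def glueSum (F F' : ArrowTangle n) (p : Bool × Vtx n) (ℓ : ℕ) : ℤ :=
  walkSum (F.toFlatTangle.glueStep F'.toFlatTangle) (F.glueParity F') (F.glueLabel F') p ℓ

/-- The value `g` of the arc of `E ⊔ E'` that starts in the exterior point `u`. -/
def arcSum (F F' : ArrowTangle n) (u : Vtx n) : ℤ :=
  F.glueSum F' (u.1, u) (F.toFlatTangle.exitTime F'.toFlatTangle u + 1)

theorem odd_parity (F : ArrowTangle n) (v : Vtx n) : Odd (F.parity v) := by
  unfold parity
  split_ifs <;> decide

theorem odd_orientedLabel (F : ArrowTangle n) (v : Vtx n) :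
    Odd (F.orientedLabel v) ↔ (F.partner v).1 = v.1 := by
  rw [← F.odd_label_iff v]
  unfold orientedLabel
  split_ifs
  · rfl
  · simp [Int.odd_mul, odd_parity]

theorem odd_glueLabel (F F' : ArrowTangle n) (p : Bool × Vtx n) :
    Odd (F.glueLabel F' p) ↔
      (F.toFlatTangle.glueMate F'.toFlatTangle p).2.1 = p.2.1 := by
  obtain ⟨t, v⟩ := p
  cases t <;> simp [glueLabel, FlatTangle.glueMate, odd_orientedLabel]

theorem odd_glueSum (F F' : ArrowTangle n) (p : Bool × Vtx n) (k : ℕ) :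
    Odd (F.glueSum F' p (k + 1)) ↔ (F.toFlatTangle.glueMate F'.toFlatTangle
      ((F.toFlatTangle.glueStep F'.toFlatTangle)^[k] p)).2.1 = p.2.1 := by
  have hprod : ∀ m, Odd (∏ j ∈ range m,
      F.glueParity F' ((F.toFlatTangle.glueStep F'.toFlatTangle)^[j] p)) := by
    intro m
    induction m with
    | zero => simp
    | succ m ih =>
      rw [prod_range_succ, Int.odd_mul]
      exact ⟨ih, odd_parity _ _⟩
  induction k with
  | zero => simp [glueSum, walkSum, odd_glueLabel]
  | succ k ih =>
    have hs : F.glueSum F' p (k + 1 + 1) = F.glueSum F' p (k + 1) +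
        (∏ j ∈ range (k + 1), F.glueParity F' ((F.toFlatTangle.glueStep F'.toFlatTangle)^[j] p)) *
          F.glueLabel F' ((F.toFlatTangle.glueStep F'.toFlatTangle)^[k + 1] p) := by
      rw [glueSum, walkSum, sum_range_succ]
      rfl
    rw [hs, Int.odd_add, ← Int.not_odd_iff_even, Int.odd_mul, odd_glueLabel]
    simp only [hprod, true_and, ih]
    rw [Function.iterate_succ_apply']
    set q := F.toFlatTangle.glueMate F'.toFlatTangle
      ((F.toFlatTangle.glueStep F'.toFlatTangle)^[k] p) with hq
    have hstep : F.toFlatTangle.glueStep F'.toFlatTangle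
        ((F.toFlatTangle.glueStep F'.toFlatTangle)^[k] p) = FlatTangle.glueCross q := rfl
    rw [hstep]
    generalize (F.toFlatTangle.glueMate F'.toFlatTangle (FlatTangle.glueCross q)).2.1 = x
    have hx : (FlatTangle.glueCross q).2.1 = !q.2.1 := rfl
    rw [hx]
    generalize q.2.1 = y
    generalize p.2.1 = w
    revert x y w
    decide

/-- The arrow flat tangle `F * F' = (E * E', g)`; the value of an arc is computed from its smaller
end. -/
def concat (F F' : ArrowTangle n) : ArrowTangle n where
  toFlatTangle := F.toFlatTangle.concat F'.toFlatTangle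
  label u :=
    if Vtx.Before u ((F.toFlatTangle.concat F'.toFlatTangle).partner u) then F.arcSum F' u
    else F.arcSum F' ((F.toFlatTangle.concat F'.toFlatTangle).partner u)
  label_partner u := by
    have h := Vtx.before_trichotomy u _
      ((F.toFlatTangle.concat F'.toFlatTangle).partner_ne u).symm
    simp only [(F.toFlatTangle.concat F'.toFlatTangle).partner_partner, h]
    split_ifs <;> rfl
  odd_label_iff u := by
    have key : ∀ v, Odd (F.arcSum F' v) ↔
        ((F.toFlatTangle.concat F'.toFlatTangle).partner v).1 = v.1 := fun v =>
      odd_glueSum F F' (v.1, v) _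
    split_ifs
    · exact key u
    · rw [key, (F.toFlatTangle.concat F'.toFlatTangle).partner_partner]
      exact eq_comm

/-- The number of zigzags of the cycle of `E ⊔ E'` recorded by the column `b`. -/
noncomputable def glueZigzags (F F' : ArrowTangle n) (b : Fin n) : ℕ :=
  (F.glueSum F' (false, (true, b))
    (F.toFlatTangle.glueCycleLength F'.toFlatTangle b)).natAbs / 2

/-- The value `h` of the cycle of the closure of `E` recorded by the column `b`. -/
noncomputable def closureSum (F : ArrowTangle n) (b : Fin n) : ℤ :=
  walkSum F.toFlatTangle.closureStep F.parity F.orientedLabel (false, b)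
    (F.toFlatTangle.closureCycleLength b)

/-- The number of zigzags of the cycle of the closure of `E` recorded by the column `b`. -/
noncomputable def closureZigzags (F : ArrowTangle n) (b : Fin n) : ℕ := (F.closureSum b).natAbs / 2

/-- The identity tangle with all labels `0`. -/
def identity (n : ℕ) : ArrowTangle n where
  toFlatTangle := FlatTangle.identity n
  label _ := 0
  label_partner _ := rfl
  odd_label_iff v := by simp [FlatTangle.identity, Vtx.opp]

/-- The arrow flat tangle `F_i`: the tangle `E_i` with label `1` on the arcs `{(0,i),(0,i+1)}` and
`{(1,i),(1,i+1)}` and label `0` on the other arcs. -/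
def cupCap (i : Fin (n - 1)) : ArrowTangle n where
  toFlatTangle := FlatTangle.cupCap i
  label v := if v.2 = FlatTangle.leftCol i ∨ v.2 = FlatTangle.rightCol i then 1 else 0
  label_partner v := by
    obtain ⟨a, b⟩ := v
    by_cases h1 : b = FlatTangle.leftCol i
    · simp [FlatTangle.cupCap, h1]
    · by_cases h2 : b = FlatTangle.rightCol i
      · subst h2
        simp [FlatTangle.cupCap, h1]
      · simp [FlatTangle.cupCap, h1, h2, Vtx.opp]
  odd_label_iff v := by
    obtain ⟨a, b⟩ := v
    by_cases h1 : b = FlatTangle.leftCol i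
    · simp [FlatTangle.cupCap, h1]
    · by_cases h2 : b = FlatTangle.rightCol i
      · subst h2
        simp [FlatTangle.cupCap, h1]
      · simp [FlatTangle.cupCap, h1, h2, Vtx.opp]

end ArrowTangle

/-! ### The algebra `VTL_n(R^f)` and its trace -/

/-- `VTL_n(R^f)`: the free `R^f`-module on the flat virtual `n`-tangles. -/
def VTL (n : ℕ) : Type := FlatTangle n →₀ Rf

namespace VTL

variable {n : ℕ}

noncomputable instance : AddCommGroup (VTL n) := inferInstanceAs (AddCommGroup (FlatTangle n →₀ Rf))

noncomputable instance : Module Rf (VTL n) := inferInstanceAs (Module Rf (FlatTangle n →₀ Rf))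

/-- The basis element given by a tangle. -/
noncomputable def of (E : FlatTangle n) : VTL n := Finsupp.single E (1 : Rf)

/-- The bilinear map with `E E' = z^m (E * E')`, where `m` is the number of cycles of `E ⊔ E'`. -/
noncomputable def mulMap : VTL n →ₗ[Rf] VTL n →ₗ[Rf] VTL n :=
  Finsupp.linearCombination (M := VTL n →ₗ[Rf] VTL n) Rf fun E : FlatTangle n =>
    Finsupp.linearCombination (M := VTL n) Rf fun E' : FlatTangle n =>
      loopValue ^ #(E.glueCycles E') • of (E.concat E')

noncomputable instance : NonUnitalNonAssocRing (VTL n) where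
  mul x y := mulMap x y
  left_distrib x y z := (mulMap x).map_add y z
  right_distrib x y z := by
    change mulMap (x + y) z = mulMap x z + mulMap y z
    rw [map_add, LinearMap.add_apply]
  zero_mul x := by
    change mulMap 0 x = 0
    rw [map_zero, LinearMap.zero_apply]
  mul_zero x := (mulMap x).map_zero

noncomputable instance : One (VTL n) := ⟨of (FlatTangle.identity n)⟩

/-- The element `E_i` of `VTL_n(R^f)`. -/
noncomputable def E (i : Fin (n - 1)) : VTL n := of (FlatTangle.cupCap i)

/-- The trace `T'^f_n`: the linear map that sends `E` to `z^t`, where `t` is the number of closed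
curves in the closure of `E`. -/
noncomputable def trace (n : ℕ) : VTL n →ₗ[Rf] Rf :=
  Finsupp.linearCombination (M := Rf) Rf fun E : FlatTangle n => loopValue ^ #E.closureCycles

end VTL

/-! ### The algebra `ATL_n(R^a)` and its trace -/

/-- `ATL_n(R^a)`: the free `R^a`-module on the arrow flat `n`-tangles. -/
def ATL (n : ℕ) : Type := ArrowTangle n →₀ Ra

namespace ATL

variable {n : ℕ}

noncomputable instance : AddCommGroup (ATL n) :=
  inferInstanceAs (AddCommGroup (ArrowTangle n →₀ Ra))

noncomputable instance : Module Ra (ATL n) := inferInstanceAs (Module Ra (ArrowTangle n →₀ Ra))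

noncomputable instance : Module Rf (ATL n) := inferInstanceAs (Module Rf (ArrowTangle n →₀ Ra))

/-- The basis element given by an arrow flat tangle. -/
noncomputable def of (F : ArrowTangle n) : ATL n := Finsupp.single F (1 : Ra)

/-- The bilinear map with `F F' = z_{ζ(γ₁)} ⋯ z_{ζ(γ_m)} (F * F')`, where `γ₁, …, γ_m` are the cycles
of `E ⊔ E'`. -/
noncomputable def mulMap : ATL n →ₗ[Ra] ATL n →ₗ[Ra] ATL n :=
  Finsupp.linearCombination (M := ATL n →ₗ[Ra] ATL n) Ra fun F : ArrowTangle n =>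
    Finsupp.linearCombination (M := ATL n) Ra fun F' : ArrowTangle n =>
      (∏ b ∈ F.toFlatTangle.glueCycles F'.toFlatTangle, arrowVar (F.glueZigzags F' b)) •
        of (F.concat F')

noncomputable instance : NonUnitalNonAssocRing (ATL n) where
  mul x y := mulMap x y
  left_distrib x y z := (mulMap x).map_add y z
  right_distrib x y z := by
    change mulMap (x + y) z = mulMap x z + mulMap y z
    rw [map_add, LinearMap.add_apply]
  zero_mul x := by
    change mulMap 0 x = 0
    rw [map_zero, LinearMap.zero_apply]
  mul_zero x := (mulMap x).map_zero

noncomputable instance : One (ATL n) := ⟨of (ArrowTangle.identity n)⟩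

/-- The element `F_i` of `ATL_n(R^a)`. -/
noncomputable def F (i : Fin (n - 1)) : ATL n := of (ArrowTangle.cupCap i)

/-- The trace `T'^a_n`: the linear map that sends `F = (E, f)` to `z_{ζ(γ₁)} ⋯ z_{ζ(γ_m)}`, where
`γ₁, …, γ_m` are the cycles of the closure of `E`. -/
noncomputable def trace (n : ℕ) : ATL n →ₗ[Ra] Ra :=
  Finsupp.linearCombination (M := Ra) Ra fun F : ArrowTangle n =>
    ∏ b ∈ F.toFlatTangle.closureCycles, arrowVar (F.closureZigzags b)

end ATL

/-! ### The Temperley–Lieb algebra -/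

/-- The defining relations of the Temperley–Lieb algebra, for generators `E_1, …, E_{n-1}`. -/
inductive TLRel (n : ℕ) : FreeAlgebra Rf (Fin (n - 1)) → FreeAlgebra Rf (Fin (n - 1)) → Prop
  | square (i : Fin (n - 1)) :
      TLRel n (FreeAlgebra.ι Rf i * FreeAlgebra.ι Rf i) (loopValue • FreeAlgebra.ι Rf i)
  | far (i j : Fin (n - 1)) (h : (i : ℕ) + 2 ≤ j ∨ (j : ℕ) + 2 ≤ i) :
      TLRel n (FreeAlgebra.ι Rf i * FreeAlgebra.ι Rf j) (FreeAlgebra.ι Rf j * FreeAlgebra.ι Rf i)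
  | near (i j : Fin (n - 1)) (h : (i : ℕ) + 1 = j ∨ (j : ℕ) + 1 = i) :
      TLRel n (FreeAlgebra.ι Rf i * FreeAlgebra.ι Rf j * FreeAlgebra.ι Rf i) (FreeAlgebra.ι Rf i)

/-- `TL_n(R^f)`, the `R^f`-algebra defined by the Temperley–Lieb presentation. -/
abbrev TL (n : ℕ) : Type := RingQuot (TLRel n)

/-- The generator `E_i` of `TL_n(R^f)`. -/
noncomputable def TL.E {n : ℕ} (i : Fin (n - 1)) : TL n :=
  RingQuot.mkAlgHom Rf (TLRel n) (FreeAlgebra.ι Rf i)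

/-! The existence of ε requires associativity, unit laws and the Temperley–Lieb relations in `VTL`.
These are checked by specializing the loop value to 2. Let `transfer E` be the 0/1 matrix of those
two-colourings of the two sides that are constant on arcs. A closed curve in a concatenation carries
one free colour, so the product of two such matrices is 2^m times the matrix of the concatenation
(`transfer_mul`). The pair (m, E) can be recovered from 2^m times the matrix
(`pow_smul_transfer_inj`), so every equality between products of basis tangles with powers of z
becomes an identity of matrices over ℕ.

For the arrow side, call a labelled tangle straight if the oriented label of each arc is the
difference of the columns of its ends, with a sign depending on the starting side. The parities
produce exactly these signs, so values of walks telescope (`walkSum_eq`). Hence closed curves have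
value 0, concatenation preserves straightness, and the identity and all F_i are straight. A straight
labelling is determined by the flat tangle (`Straight.ext`).

Thus ε takes values in the span of the flat tangles with straight labellings, on which `straighten`
adds the labels, is multiplicative and respects traces, since only z₀ = z occurs. The map ι is
`straighten` after ε; no relation has to be checked in `ATL`, nor its associativity. Uniqueness
holds because the E_i generate. -/

namespace FlatTangle

variable {n : ℕ}

/-! ### The transfer matrix of a flat tangle -/

/-- The colouring of `V_n` given by colourings of its two sides. -/
def sideColour (x y : Fin n → Bool) (v : Vtx n) : Bool := if v.1 then y v.2 else x v.2

/-- The colouring of `V_n` is constant on the arcs of `E`. -/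
def Compat (E : FlatTangle n) (x y : Fin n → Bool) : Prop :=
  ∀ v, sideColour x y (E.partner v) = sideColour x y v

instance (E : FlatTangle n) (x y : Fin n → Bool) : Decidable (E.Compat x y) :=
  inferInstanceAs (Decidable (∀ _, _))

/-- The matrix, indexed by the colourings of the two sides, that tells which colourings are constant
on the arcs of `E`. -/
def transfer (E : FlatTangle n) : Matrix (Fin n → Bool) (Fin n → Bool) ℕ :=
  Matrix.of fun x y => if E.Compat x y then 1 else 0

theorem transfer_apply (E : FlatTangle n) (x y : Fin n → Bool) :
    E.transfer x y = if E.Compat x y then 1 else 0 := rfl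

/-- The constant colouring is compatible with every tangle, so its entry gives the exponent. The
arcs are then detected by the colourings that single out one arc of `E`. -/
theorem pow_smul_transfer_inj {E E' : FlatTangle n} {a b : ℕ}
    (h : 2 ^ a • E.transfer = 2 ^ b • E'.transfer) : a = b ∧ E = E' := by
  have hc : ∀ X : FlatTangle n, X.Compat (fun _ => true) (fun _ => true) := fun X v => by
    simp [sideColour]
  have hab : 2 ^ a = 2 ^ b := by
    have := congrFun (congrFun h fun _ => true) fun _ => true
    simpa [transfer_apply, hc] using this
  refine ⟨Nat.pow_right_injective le_rfl hab, ?_⟩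
  ext1
  funext v
  -- The indicator of the arc of `E` at `v`. Once it is known to be constant on the arcs of `E'`,
  -- the `E'`-partner of `v` must lie on this arc.
  let z : Vtx n → Bool := fun u => decide (u = v ∨ u = E.partner v)
  have hz : sideColour (fun b => z (false, b)) (fun b => z (true, b)) = z := by
    funext ⟨a, b⟩
    cases a <;> rfl
  have hE : E.Compat (fun b => z (false, b)) (fun b => z (true, b)) := by
    intro u
    rw [hz]
    have h1 : E.partner u = v ↔ u = E.partner v :=
      ⟨fun h => by rw [← h, E.partner_partner], fun h => by rw [h, E.partner_partner]⟩
    have h2 : E.partner u = E.partner v ↔ u = v :=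
      ⟨fun h => by rw [← E.partner_partner u, h, E.partner_partner], fun h => by rw [h]⟩
    simp only [z, h1, h2, or_comm]
  have hE' : E'.Compat (fun b => z (false, b)) (fun b => z (true, b)) := by
    have := congrFun (congrFun h fun b => z (false, b)) fun b => z (true, b)
    rw [Matrix.smul_apply, Matrix.smul_apply, transfer_apply, transfer_apply, if_pos hE, hab] at this
    by_contra hne
    simp [hne] at this
  have := hE' v
  rw [hz] at this
  simp only [z, E'.partner_ne v, true_or, decide_true, false_or, decide_eq_true_eq] at this
  exact this.symm

/-! ### Connected components of `E ⊔ E'` -/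

/-- Two points of `E ⊔ E'` are adjacent if they are the ends of an arc or glued to each other. -/
inductive GlueAdj (E E' : FlatTangle n) : Bool × Vtx n → Bool × Vtx n → Prop
  | mate (p) : GlueAdj E E' p (glueMate E E' p)
  | cross (p) (h : ¬ Exterior p) : GlueAdj E E' p (glueCross p)

/-- Two points of `E ⊔ E'` lie on the same arc or cycle. -/
def GlueConn (E E' : FlatTangle n) : Bool × Vtx n → Bool × Vtx n → Prop :=
  Relation.ReflTransGen (GlueAdj E E')

variable {E E' : FlatTangle n}

theorem GlueAdj.symm {p q : Bool × Vtx n} (h : GlueAdj E E' p q) : GlueAdj E E' q p := by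
  cases h with
  | mate =>
    have := GlueAdj.mate (E := E) (E' := E') (glueMate E E' p)
    rwa [glueMate_glueMate] at this
  | cross h =>
    have := GlueAdj.cross (E := E) (E' := E') (glueCross p) (by rwa [exterior_glueCross])
    rwa [glueCross_glueCross] at this

theorem GlueConn.symm {p q : Bool × Vtx n} (h : GlueConn E E' p q) : GlueConn E E' q p := by
  induction h with
  | refl => exact Relation.ReflTransGen.refl
  | tail _ hab ih => exact Relation.ReflTransGen.head hab.symm ih

theorem GlueConn.refl (p : Bool × Vtx n) : GlueConn E E' p p := Relation.ReflTransGen.refl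

theorem GlueConn.trans {p q r : Bool × Vtx n} (h : GlueConn E E' p q) (h' : GlueConn E E' q r) :
    GlueConn E E' p r := Relation.ReflTransGen.trans h h'

theorem GlueConn.mate (p : Bool × Vtx n) : GlueConn E E' p (glueMate E E' p) :=
  Relation.ReflTransGen.single (.mate p)

theorem GlueConn.cross {p : Bool × Vtx n} (h : ¬ Exterior p) : GlueConn E E' p (glueCross p) :=
  Relation.ReflTransGen.single (.cross p h)

/-- A set of points that is closed under adjacency contains the components of its members. -/
theorem GlueConn.induction {P : Bool × Vtx n → Prop} {p q : Bool × Vtx n} (h : GlueConn E E' p q)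
    (hp : P p) (hm : ∀ r, P r → P (glueMate E E' r))
    (hc : ∀ r, ¬ Exterior r → P r → P (glueCross r)) : P q := by
  induction h with
  | refl => exact hp
  | tail _ hab ih =>
    cases hab with
    | mate => exact hm _ ih
    | cross h => exact hc _ h ih

theorem glueCross_glueStep (p : Bool × Vtx n) : glueCross (glueStep E E' p) = glueMate E E' p :=
  glueCross_glueCross _

theorem exterior_glueStep (p : Bool × Vtx n) :
    Exterior (glueStep E E' p) ↔ Exterior (glueMate E E' p) := exterior_glueCross _

theorem glueConn_iterate_of_not_exterior (p : Bool × Vtx n) (k : ℕ)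
    (h : ∀ j < k, ¬ Exterior (glueMate E E' ((glueStep E E')^[j] p))) :
    GlueConn E E' p ((glueStep E E')^[k] p) := by
  induction k with
  | zero => exact .refl p
  | succ k ih =>
    rw [Function.iterate_succ_apply']
    exact ((ih fun j hj => h j (by omega)).trans (.mate _)).trans (.cross (h k (by omega)))

theorem glueConn_concatPartner (u : Vtx n) :
    GlueConn E E' (u.1, u) (((E.concat E').partner u).1, (E.concat E').partner u) := by
  change GlueConn E E' (u.1, u) ((concatPartner E E' u).1, concatPartner E E' u)
  rw [concat_end]
  exact (glueConn_iterate_of_not_exterior _ _ fun j hj => Nat.find_min (exists_exit E E' u) hj).trans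
    (.mate _)

/-- The exterior points on an arc of `E ⊔ E'` are its two ends. -/
theorem eq_or_eq_concat_of_glueConn {u : Vtx n} {q : Bool × Vtx n} (h : GlueConn E E' (u.1, u) q)
    (hq : Exterior q) : q.2 = u ∨ q.2 = (E.concat E').partner u := by
  -- The starts and ends of the arcs run up to the exit time form a set closed under adjacency:
  -- crossing is excluded at both exterior ends.
  have hmem : ∃ k ≤ exitTime E E' u, q = (glueStep E E')^[k] (u.1, u) ∨
      q = glueMate E E' ((glueStep E E')^[k] (u.1, u)) := by
    refine h.induction (P := fun q => ∃ k ≤ exitTime E E' u, q = (glueStep E E')^[k] (u.1, u) ∨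
      q = glueMate E E' ((glueStep E E')^[k] (u.1, u))) ⟨0, Nat.zero_le _, Or.inl rfl⟩ ?_ ?_
    · rintro r ⟨k, hk, rfl | rfl⟩
      · exact ⟨k, hk, Or.inr rfl⟩
      · exact ⟨k, hk, Or.inl (glueMate_glueMate _ _ _)⟩
    · rintro r hr ⟨k, hk, rfl | rfl⟩
      · cases k with
        | zero => exact absurd (exterior_start u) hr
        | succ k =>
          refine ⟨k, by omega, Or.inr ?_⟩
          rw [Function.iterate_succ_apply', glueCross_glueStep]
      · have hk' : k ≠ exitTime E E' u := by
          rintro rfl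
          exact hr (Nat.find_spec (exists_exit E E' u))
        exact ⟨k + 1, by omega, Or.inl (by rw [Function.iterate_succ_apply']; rfl)⟩
  obtain ⟨k, hk, rfl | rfl⟩ := hmem
  · cases k with
    | zero => exact Or.inl rfl
    | succ k =>
      rw [Function.iterate_succ_apply', exterior_glueStep] at hq
      exact absurd hq (Nat.find_min (exists_exit E E' u) hk)
  · have hk' : k = exitTime E E' u :=
      le_antisymm hk (not_lt.1 fun hlt => Nat.find_min (exists_exit E E' u) hlt hq)
    subst hk'
    exact Or.inr rfl

/-- The recorded columns are the smallest columns of the components without exterior points. -/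
theorem mem_glueCycles_iff {b : Fin n} : b ∈ E.glueCycles E' ↔
    ∀ q, GlueConn E E' (false, (true, b)) q → ¬ Exterior q ∧ b ≤ q.2.2 := by
  simp only [glueCycles, mem_filter, mem_univ, true_and]
  constructor
  · intro h q hq
    have hmem : ∃ k, q = (glueStep E E')^[k] (false, (true, b)) ∨
        q = glueMate E E' ((glueStep E E')^[k] (false, (true, b))) := by
      refine hq.induction (P := fun q => ∃ k, q = (glueStep E E')^[k] (false, (true, b)) ∨
        q = glueMate E E' ((glueStep E E')^[k] (false, (true, b)))) ⟨0, Or.inl rfl⟩ ?_ ?_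
      · rintro r ⟨k, rfl | rfl⟩
        · exact ⟨k, Or.inr rfl⟩
        · exact ⟨k, Or.inl (glueMate_glueMate _ _ _)⟩
      · rintro r - ⟨k, rfl | rfl⟩
        -- Crossing at the start of an arc leads to the end of the previous one, with index k - 1.
        -- Adding a positive period N avoids a negative index when k = 0.
        · obtain ⟨N, hN, hper⟩ := (glueStep_injective E E').mem_periodicPts (false, (true, b))
          refine ⟨k + (N - 1), Or.inr ?_⟩
          rw [← glueCross_glueStep, ← Function.iterate_succ_apply' (glueStep E E'),
            show (k + (N - 1)).succ = k + N by omega, Function.iterate_add_apply, hper]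
        · exact ⟨k + 1, Or.inl (by rw [Function.iterate_succ_apply']; rfl)⟩
    obtain ⟨k, rfl | rfl⟩ := hmem
    · refine ⟨?_, (h k).2⟩
      cases k with
      | zero => simp [Exterior]
      | succ k =>
        rw [Function.iterate_succ_apply', exterior_glueStep]
        exact (h k).1
    · refine ⟨(h k).1, ?_⟩
      have := (h (k + 1)).2
      rwa [Function.iterate_succ_apply'] at this
  · intro h i
    have hi : GlueConn E E' (false, (true, b)) ((glueStep E E')^[i] (false, (true, b))) := by
      induction i with
      | zero => exact .refl _
      | succ i ih =>
        rw [Function.iterate_succ_apply']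
        have hm := ih.trans (.mate _)
        exact hm.trans (.cross (h _ hm).1)
    exact ⟨(h _ (hi.trans (.mate _))).1, (h _ hi).2⟩

/-! ### Counting colourings of the interface -/

/-- The colouring of the points of `E ⊔ E'` given by colourings of side `0` of `E`, of the interface
and of side `1` of `E'`. -/
def glueColour (x y w : Fin n → Bool) (p : Bool × Vtx n) : Bool :=
  if p.1 then sideColour y w p.2 else sideColour x y p.2

theorem compat_and_compat_iff {x y w : Fin n → Bool} : E.Compat x y ∧ E'.Compat y w ↔
    ∀ p, glueColour x y w (glueMate E E' p) = glueColour x y w p := by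
  simp only [Prod.forall, Bool.forall_bool, glueColour, glueMate, Compat]
  simp

theorem glueColour_of_exterior {x y w : Fin n → Bool} {p : Bool × Vtx n} (h : Exterior p) :
    glueColour x y w p = sideColour x w p.2 := by
  obtain ⟨t, a, b⟩ := p
  cases t <;> cases a <;> simp_all [Exterior, glueColour, sideColour]

theorem glueColour_of_not_exterior {x y w : Fin n → Bool} {p : Bool × Vtx n} (h : ¬ Exterior p) :
    glueColour x y w p = y p.2.2 := by
  obtain ⟨t, a, b⟩ := p
  cases t <;> cases a <;> simp_all [Exterior, glueColour, sideColour]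

theorem glueConn_of_not_exterior {p : Bool × Vtx n} (h : ¬ Exterior p) :
    GlueConn E E' (false, (true, p.2.2)) p := by
  obtain ⟨t, a, b⟩ := p
  cases t <;> cases a
  · exact absurd rfl h
  · exact .refl _
  · exact .cross (p := (false, (true, b))) (by simp [Exterior])
  · exact absurd rfl h

/-- Compatibility handles the arcs; glued points read the same entry of the interface colouring `y`.
-/
theorem glueColour_of_glueConn {x y w : Fin n → Bool} (h1 : E.Compat x y) (h2 : E'.Compat y w)
    {p q : Bool × Vtx n} (h : GlueConn E E' p q) : glueColour x y w q = glueColour x y w p := by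
  refine h.induction (P := fun q => glueColour x y w q = glueColour x y w p) rfl ?_ ?_
  · intro r hr
    rw [compat_and_compat_iff.1 ⟨h1, h2⟩, hr]
  · intro r hr hrp
    rw [← hrp, glueColour_of_not_exterior hr,
      glueColour_of_not_exterior (by rwa [exterior_glueCross])]
    rfl

theorem Compat.concat {x y w : Fin n → Bool} (h1 : E.Compat x y) (h2 : E'.Compat y w) :
    (E.concat E').Compat x w := by
  intro u
  have h := glueColour_of_glueConn h1 h2 (glueConn_concatPartner u)
  rwa [glueColour_of_exterior (exterior_start _), glueColour_of_exterior (exterior_start _)] at h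

/-- Every component without exterior points meets a recorded column. -/
theorem exists_mem_glueCycles {p : Bool × Vtx n}
    (h : ∀ q, GlueConn E E' p q → ¬ Exterior q) :
    ∃ b ∈ E.glueCycles E', GlueConn E E' p (false, (true, b)) := by
  classical
  obtain ⟨q, hq, hmin⟩ := exists_min_image (univ.filter fun q => GlueConn E E' p q)
    (fun q => q.2.2) ⟨p, by simpa using GlueConn.refl p⟩
  simp only [mem_filter, mem_univ, true_and] at hq hmin
  have hb : GlueConn E E' p (false, (true, q.2.2)) :=
    hq.trans (glueConn_of_not_exterior (h q hq)).symm
  exact ⟨q.2.2, mem_glueCycles_iff.2 fun r hr =>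
    ⟨h r (hb.trans hr), hmin r (hb.trans hr)⟩, hb⟩

theorem eq_of_mem_glueCycles {b c : Fin n} (hb : b ∈ E.glueCycles E') (hc : c ∈ E.glueCycles E')
    (h : GlueConn E E' (false, (true, b)) (false, (true, c))) : b = c :=
  le_antisymm (mem_glueCycles_iff.1 hb _ h).2 (mem_glueCycles_iff.1 hc _ h.symm).2

/-- A colouring of the interface is determined by its values on the recorded columns. -/
theorem eq_of_eq_on_glueCycles {x y y' w : Fin n → Bool} (h1 : E.Compat x y) (h2 : E'.Compat y w)
    (h1' : E.Compat x y') (h2' : E'.Compat y' w) (h : ∀ b ∈ E.glueCycles E', y b = y' b) :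
    y = y' := by
  funext b
  have hb : ∀ (z : Fin n → Bool) (c : Fin n), glueColour x z w (false, (true, c)) = z c :=
    fun z c => glueColour_of_not_exterior (by simp [Exterior])
  by_cases hex : ∃ q, GlueConn E E' (false, (true, b)) q ∧ Exterior q
  · obtain ⟨q, hq, hext⟩ := hex
    rw [← hb y, ← hb y', ← glueColour_of_glueConn h1 h2 hq, ← glueColour_of_glueConn h1' h2' hq,
      glueColour_of_exterior hext, glueColour_of_exterior hext]
  · obtain ⟨c, hc, hbc⟩ := exists_mem_glueCycles fun q hq hext => hex ⟨q, hq, hext⟩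
    rw [← hb y, ← hb y', ← glueColour_of_glueConn h1 h2 hbc, ← glueColour_of_glueConn h1' h2' hbc,
      hb, hb, h c hc]

/-- Every colouring of the recorded columns extends to the interface. -/
theorem exists_compat {x w : Fin n → Bool} (h : (E.concat E').Compat x w) (g : Fin n → Bool) :
    ∃ y, E.Compat x y ∧ E'.Compat y w ∧ ∀ b ∈ E.glueCycles E', y b = g b := by
  -- The two prescriptions never conflict: a component either has as exterior points the two ends of
  -- one arc of the concatenation, which `x` and `w` colour equally, or is closed and has exactly
  -- one recorded column.
  have hex : ∀ p, ∃ a : Bool, (∀ q, GlueConn E E' p q → Exterior q → sideColour x w q.2 = a) ∧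
      ∀ b ∈ E.glueCycles E', GlueConn E E' p (false, (true, b)) → g b = a := by
    intro p
    by_cases hex : ∃ q, GlueConn E E' p q ∧ Exterior q
    · obtain ⟨q, hq, hext⟩ := hex
      refine ⟨sideColour x w q.2, fun r hr hrext => ?_, fun b hb hpb =>
        absurd hext (mem_glueCycles_iff.1 hb q (hpb.symm.trans hq)).1⟩
      have hqr := hq.symm.trans hr
      rw [← start_of_exterior hext] at hqr
      rcases eq_or_eq_concat_of_glueConn hqr hrext with hr | hr
      · rw [hr]
      · rw [hr, h]
    · obtain ⟨c, hc, hpc⟩ := exists_mem_glueCycles fun q hq hext => hex ⟨q, hq, hext⟩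
      exact ⟨g c, fun q hq hext => absurd ⟨q, hq, hext⟩ hex, fun b hb hpb =>
        congrArg g (eq_of_mem_glueCycles hb hc (hpb.symm.trans hpc))⟩
  choose C hC hCg using hex
  -- The choice is made point by point, but every component contains an exterior point or a recorded
  -- column, which forces the value.
  have hconn : ∀ p q, GlueConn E E' p q → C q = C p := by
    intro p q hpq
    by_cases hex : ∃ r, GlueConn E E' p r ∧ Exterior r
    · obtain ⟨r, hr, hext⟩ := hex
      rw [← hC p r hr hext, ← hC q r (hpq.symm.trans hr) hext]
    · obtain ⟨c, hc, hpc⟩ := exists_mem_glueCycles fun q hq hext => hex ⟨q, hq, hext⟩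
      rw [← hCg p c hc hpc, ← hCg q c hc (hpq.symm.trans hpc)]
  have hcol : ∀ p, glueColour x (fun b => C (false, (true, b))) w p = C p := by
    intro p
    by_cases hp : Exterior p
    · rw [glueColour_of_exterior hp, hC p p (.refl p) hp]
    · rw [glueColour_of_not_exterior hp, hconn _ _ (glueConn_of_not_exterior hp)]
  have hcompat := compat_and_compat_iff (E := E) (E' := E') (x := x) (w := w)
    (y := fun b => C (false, (true, b))) |>.2 fun p => by
      rw [hcol, hcol, hconn _ _ (.mate p)]
  exact ⟨_, hcompat.1, hcompat.2, fun b hb => (hCg _ b hb (.refl _)).symm⟩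

/-- An entry of the product counts the interface colourings compatible with both tangles. Components
with ends have their colour forced by the exterior, and each closed curve can be coloured freely in
two ways. -/
theorem transfer_mul (E E' : FlatTangle n) :
    E.transfer * E'.transfer = 2 ^ #(E.glueCycles E') • (E.concat E').transfer := by
  ext x w
  have hsum : (E.transfer * E'.transfer) x w = #{y | E.Compat x y ∧ E'.Compat y w} := by
    simp only [Matrix.mul_apply, transfer_apply, card_filter, ite_and, ite_mul, one_mul, zero_mul]
  rw [hsum, Matrix.smul_apply, transfer_apply]
  split_ifs with h
  · have hcard : #{y | E.Compat x y ∧ E'.Compat y w} =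
        Fintype.card ({b // b ∈ E.glueCycles E'} → Bool) := by
      rw [← card_univ]
      refine card_bij (fun y _ b => y b.1) (fun _ _ => mem_univ _) ?_ ?_
      · intro y hy y' hy' hyy'
        simp only [mem_filter, mem_univ, true_and] at hy hy'
        exact eq_of_eq_on_glueCycles hy.1 hy.2 hy'.1 hy'.2 fun b hb => congrFun hyy' ⟨b, hb⟩
      · intro g _
        classical
        obtain ⟨y, h1, h2, hy⟩ :=
          exists_compat h fun b => if hb : b ∈ E.glueCycles E' then g ⟨b, hb⟩ else false
        refine ⟨y, by simp [h1, h2], ?_⟩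
        funext ⟨b, hb⟩
        rw [hy b hb, dif_pos hb]
    rw [hcard]
    simp
  · rw [smul_zero, card_eq_zero, filter_eq_empty_iff]
    exact fun y _ hy => h (hy.1.concat hy.2)

/-! ### Transfer matrices of the identity and of the generators -/

theorem transfer_identity : (identity n).transfer = 1 := by
  ext x y
  rw [transfer_apply, Matrix.one_apply]
  congr 1
  simp only [Compat, identity, Vtx.opp, sideColour, funext_iff, Prod.forall, Bool.forall_bool]
  simp only [Bool.not_false, Bool.not_true, if_true, Bool.false_eq_true, if_false, eq_iff_iff]
  exact ⟨fun h b => h.2 b, fun h => ⟨fun b => (h b).symm, h⟩⟩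

theorem leftCol_ne_rightCol (i : Fin (n - 1)) : leftCol i ≠ rightCol i := by
  simp [leftCol, rightCol]

/-- Colour both columns of the `i`-th generator by `a`. -/
def recolour (i : Fin (n - 1)) (a : Bool) (x : Fin n → Bool) (b : Fin n) : Bool :=
  if b = leftCol i ∨ b = rightCol i then a else x b

theorem compat_cupCap_iff (i : Fin (n - 1)) (x y : Fin n → Bool) : (cupCap i).Compat x y ↔
    x (leftCol i) = x (rightCol i) ∧ y = recolour i (y (leftCol i)) x := by
  have hne := leftCol_ne_rightCol i
  constructor
  · intro h
    refine ⟨by simpa [sideColour, cupCap] using (h (false, leftCol i)).symm, ?_⟩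
    funext b
    by_cases h1 : b = leftCol i
    · simp [recolour, h1]
    by_cases h2 : b = rightCol i
    · subst h2
      simpa [sideColour, cupCap, recolour] using h (true, leftCol i)
    · simpa [sideColour, cupCap, recolour, h1, h2, Vtx.opp] using h (false, b)
  · rintro ⟨hx, hy⟩ ⟨a, b⟩
    have hr : y (rightCol i) = y (leftCol i) := by
      rw [hy]
      simp [recolour]
    by_cases h1 : b = leftCol i
    · subst h1
      cases a <;> simp [sideColour, cupCap, hx, hr]
    by_cases h2 : b = rightCol i
    · subst h2
      cases a <;> simp [sideColour, cupCap, hx, hr, hne.symm]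
    · have hb : y b = x b := by
        rw [hy]
        simp [recolour, h1, h2]
      cases a <;> simp [sideColour, cupCap, h1, h2, Vtx.opp, hb]

/-- The through arcs copy `x`, and the arc on side 1 leaves only one common colour to sum over. In
this form the relations reduce to the calculus of `recolour`. -/
theorem transfer_cupCap_mulVec (i : Fin (n - 1)) (f : (Fin n → Bool) → ℕ) (x : Fin n → Bool) :
    ((cupCap i).transfer.mulVec f) x = if x (leftCol i) = x (rightCol i) then
      f (recolour i false x) + f (recolour i true x) else 0 := by
  simp only [Matrix.mulVec, dotProduct, transfer_apply, compat_cupCap_iff, ite_mul, one_mul,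
    zero_mul]
  split_ifs with h
  · have hy : ∀ y, (if y = recolour i (y (leftCol i)) x then f y else 0) =
        (if y = recolour i false x then f y else 0) +
          (if y = recolour i true x then f y else 0) := by
      intro y
      by_cases h0 : y = recolour i false x
      · have h1 : recolour i false x ≠ recolour i true x := fun h => by
          have := congrFun h (leftCol i)
          simp [recolour] at this
        subst h0
        simp [recolour, h1]
      · by_cases h1 : y = recolour i true x
        · subst h1
          simp [recolour, h0]
        · cases hya : y (leftCol i) <;> simp [h0, h1]
    simp only [h, true_and, hy, sum_add_distrib]
    simp
  · simp [h]

theorem recolour_recolour (i : Fin (n - 1)) (a c : Bool) (x : Fin n → Bool) :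
    recolour i a (recolour i c x) = recolour i a x := by
  funext b
  simp only [recolour]
  split_ifs <;> rfl

theorem transfer_cupCap_sq (i : Fin (n - 1)) :
    (cupCap i).transfer * (cupCap i).transfer = 2 • (cupCap i).transfer := by
  refine Matrix.mulVec_injective (funext fun f => funext fun x => ?_)
  rw [← Matrix.mulVec_mulVec, Matrix.smul_mulVec, Pi.smul_apply]
  simp only [transfer_cupCap_mulVec, recolour_recolour]
  simp only [recolour]
  simp [two_mul]

theorem transfer_cupCap_comm (i j : Fin (n - 1)) (h : (i : ℕ) + 2 ≤ j ∨ (j : ℕ) + 2 ≤ i) :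
    (cupCap i).transfer * (cupCap j).transfer = (cupCap j).transfer * (cupCap i).transfer := by
  have h1 : leftCol i ≠ leftCol j := by simp [leftCol]; omega
  have h2 : leftCol i ≠ rightCol j := by simp [leftCol, rightCol]; omega
  have h3 : rightCol i ≠ leftCol j := by simp [leftCol, rightCol]; omega
  have h4 : rightCol i ≠ rightCol j := by simp [rightCol]; omega
  have hcomm : ∀ a c x, recolour i a (recolour j c x) = recolour j c (recolour i a x) := by
    intro a c x
    funext b
    simp only [recolour]
    split_ifs <;> grind
  refine Matrix.mulVec_injective (funext fun f => funext fun x => ?_)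
  rw [← Matrix.mulVec_mulVec, ← Matrix.mulVec_mulVec]
  simp only [transfer_cupCap_mulVec, hcomm]
  have hi : ∀ a, recolour i a x (leftCol j) = x (leftCol j) ∧
      recolour i a x (rightCol j) = x (rightCol j) := fun a => by
    simp [recolour, h1.symm, h2.symm, h3.symm, h4.symm]
  have hj : ∀ a, recolour j a x (leftCol i) = x (leftCol i) ∧
      recolour j a x (rightCol i) = x (rightCol i) := fun a => by
    simp [recolour, h1, h2, h3, h4]
  simp only [hi, hj]
  split_ifs
  · ring
  all_goals rfl

theorem transfer_cupCap_near (i j : Fin (n - 1)) (h : (i : ℕ) + 1 = j ∨ (j : ℕ) + 1 = i) :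
    (cupCap i).transfer * (cupCap j).transfer * (cupCap i).transfer = (cupCap i).transfer := by
  -- Here `k` is the column of the `j`-th generator that the `i`-th one does not meet. The first two
  -- sums over colours then keep only the term with colour `x k`, so no factor 2 remains.
  obtain ⟨k, hj, hs, hr⟩ : ∃ k, (∀ a y, recolour i a y (leftCol j) = recolour i a y (rightCol j) ↔
      a = y k) ∧ (∀ a c y, recolour j c (recolour i a y) (leftCol i) =
      recolour j c (recolour i a y) (rightCol i) ↔ a = c) ∧
      ∀ d y, recolour i d (recolour j (y k) (recolour i (y k) y)) = recolour i d y := by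
    have hne := leftCol_ne_rightCol i
    have hnej := leftCol_ne_rightCol j
    rcases h with h | h
    · have hs : leftCol j = rightCol i := by simp [leftCol, rightCol]; omega
      have hk : rightCol j ≠ leftCol i := by simp [leftCol, rightCol]; omega
      refine ⟨rightCol j, ?_, ?_, ?_⟩
      · simp only [recolour]
        grind
      · simp only [recolour]
        grind
      · intro d y
        funext b
        simp only [recolour]
        grind
    · have hs : rightCol j = leftCol i := by simp [leftCol, rightCol]; omega
      have hk : leftCol j ≠ rightCol i := by simp [leftCol, rightCol]; omega
      refine ⟨leftCol j, ?_, ?_, ?_⟩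
      · simp only [recolour]
        grind
      · simp only [recolour]
        grind
      · intro d y
        funext b
        simp only [recolour]
        grind
  refine Matrix.mulVec_injective (funext fun f => funext fun x => ?_)
  rw [← Matrix.mulVec_mulVec, ← Matrix.mulVec_mulVec]
  simp only [transfer_cupCap_mulVec, hj, hs]
  have hf := hr false x
  have ht := hr true x
  cases hk : x k <;> rw [hk] at hf ht <;> simp [hf, ht]

end FlatTangle

/-! ### Telescoping walk values and straight labellings -/

/-- Walk sums of oriented labels that are differences of a height function, up to a sign that
changes with the parities. -/
theorem walkSum_eq {S : Type} {step : S → S} {par val : S → ℤ} {sgn height : S → ℤ}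
    (hsgn : ∀ s, sgn s * sgn s = 1) (hpar : ∀ s, sgn (step s) = sgn s * par s)
    (hval : ∀ s, val s = sgn s * (height (step s) - height s)) (s : S) (ℓ : ℕ) :
    walkSum step par val s ℓ = sgn s * (height (step^[ℓ] s) - height s) := by
  -- Each parity is the ratio of consecutive signs, so the product telescopes as well.
  have hprod : ∀ m, ∏ j ∈ range m, par (step^[j] s) = sgn s * sgn (step^[m] s) := by
    intro m
    induction m with
    | zero => simp [hsgn]
    | succ m ih => rw [prod_range_succ, ih, Function.iterate_succ_apply', hpar, mul_assoc]
  induction ℓ with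
  | zero => simp [walkSum]
  | succ ℓ ih =>
    rw [walkSum, sum_range_succ, ← walkSum, ih, hprod, hval, Function.iterate_succ_apply']
    linear_combination (sgn s * (height (step (step^[ℓ] s)) - height (step^[ℓ] s))) *
      hsgn (step^[ℓ] s)

/-- The sign of a side. -/
def Vtx.sgn {n : ℕ} (v : Vtx n) : ℤ := if v.1 then -1 else 1

/-- The column of a point, as an integer. -/
def Vtx.height {n : ℕ} (v : Vtx n) : ℤ := (v.2 : ℕ)

theorem Vtx.sgn_mul_sgn {n : ℕ} (v : Vtx n) : v.sgn * v.sgn = 1 := by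
  unfold Vtx.sgn
  split_ifs <;> rfl

namespace ArrowTangle

variable {n : ℕ}

/-- An arrow flat tangle is straight if the values of its arcs are differences of columns. -/
def Straight (F : ArrowTangle n) : Prop :=
  ∀ v, F.orientedLabel v = v.sgn * ((F.partner v).height - v.height)

/-- The minus sign is cancelled by `sgn_opp` when the walk crosses to the next arc; together they
give the sign hypothesis of `walkSum_eq`. -/
theorem sgn_partner (F : ArrowTangle n) (v : Vtx n) :
    (F.partner v).sgn = -(v.sgn * F.parity v) := by
  unfold parity Vtx.sgn
  generalize (F.partner v).1 = a
  generalize v.1 = b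
  revert a b
  decide

theorem sgn_opp (v : Vtx n) : v.opp.sgn = -v.sgn := by
  obtain ⟨a, b⟩ := v
  cases a <;> rfl

/-- Seen from the smaller end of an arc, the oriented label is the label itself, so straightness
expresses it by the columns of the two ends. -/
theorem Straight.ext {F F' : ArrowTangle n} (hF : F.Straight) (hF' : F'.Straight)
    (h : F.toFlatTangle = F'.toFlatTangle) : F = F' := by
  have key : ∀ G : ArrowTangle n, G.Straight → ∀ v, G.label v =
      if Vtx.Before v (G.partner v) then v.sgn * ((G.partner v).height - v.height)
      else (G.partner v).sgn * (v.height - (G.partner v).height) := by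
    intro G hG v
    have h1 := hG v
    have h2 := hG (G.partner v)
    have h3 := Vtx.before_trichotomy v _ (G.partner_ne v).symm
    rw [orientedLabel] at h1 h2
    rw [G.partner_partner, G.label_partner] at h2
    split_ifs with h
    · rwa [if_pos h] at h1
    · rwa [if_pos (h3.2 h)] at h2
  have hl : F.label = F'.label := funext fun v => by rw [key F hF, key F' hF', h]
  cases F
  cases F'
  subst h
  subst hl
  rfl

/-- Reversing an arc multiplies both the oriented label and the signed column difference by the
parity, so one direction suffices. -/
theorem straight_of_label {F : ArrowTangle n} (h : ∀ v, Vtx.Before v (F.partner v) →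
    F.label v = v.sgn * ((F.partner v).height - v.height)) : F.Straight := by
  intro v
  unfold orientedLabel
  split_ifs with hv
  · exact h v hv
  · have h1 := h (F.partner v) (by
      rw [F.partner_partner]
      exact (Vtx.before_trichotomy v _ (F.partner_ne v).symm).2 hv)
    rw [F.label_partner, F.partner_partner, sgn_partner] at h1
    have hp : F.parity v * F.parity v = 1 := by
      unfold parity
      split_ifs <;> rfl
    rw [h1]
    linear_combination (-v.sgn * (v.height - (F.partner v).height)) * hp

theorem straight_identity : (identity n).Straight := fun v => by
  simp [orientedLabel, identity, FlatTangle.identity, Vtx.opp, Vtx.height]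

theorem straight_cupCap (i : Fin (n - 1)) : (cupCap i).Straight := by
  refine straight_of_label fun v hv => ?_
  obtain ⟨a, b⟩ := v
  by_cases h1 : b = FlatTangle.leftCol i
  · subst h1
    cases a <;> simp [cupCap, FlatTangle.cupCap, Vtx.sgn, Vtx.height, FlatTangle.leftCol,
      FlatTangle.rightCol, Vtx.Before] at hv ⊢
  · by_cases h2 : b = FlatTangle.rightCol i
    · subst h2
      cases a <;> simp [cupCap, FlatTangle.cupCap, Vtx.sgn, Vtx.height, FlatTangle.leftCol,
        FlatTangle.rightCol, Vtx.Before] at hv ⊢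
    · simp [cupCap, FlatTangle.cupCap, h1, h2, Vtx.opp, Vtx.height]

variable {F F' : ArrowTangle n}

theorem Straight.glueSum (hF : F.Straight) (hF' : F'.Straight) (p : Bool × Vtx n) (ℓ : ℕ) :
    F.glueSum F' p ℓ = p.2.sgn *
      (((F.toFlatTangle.glueStep F'.toFlatTangle)^[ℓ] p).2.height - p.2.height) := by
  refine walkSum_eq (sgn := fun p => p.2.sgn) (height := fun p => p.2.height)
    (fun p => p.2.sgn_mul_sgn) ?_ ?_ p ℓ
  · rintro ⟨t, v⟩
    cases t <;> simp [FlatTangle.glueStep, FlatTangle.glueMate, FlatTangle.glueCross, sgn_opp,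
      sgn_partner, glueParity]
  · rintro ⟨t, v⟩
    cases t
    · exact hF v
    · exact hF' v

/-- A closed curve returns to the column where it starts, so the telescoped value vanishes. -/
theorem Straight.closureSum (hF : F.Straight) (b : Fin n) : F.closureSum b = 0 := by
  have h := walkSum_eq (step := F.closureStep) (par := F.parity) (val := F.orientedLabel)
    (sgn := Vtx.sgn) (height := Vtx.height) Vtx.sgn_mul_sgn
    (fun v => by rw [FlatTangle.closureStep, sgn_opp, sgn_partner, neg_neg]) hF (false, b)
    (F.closureCycleLength b)
  rw [ArrowTangle.closureSum, h, FlatTangle.closureCycleLength, Function.iterate_minimalPeriod,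
    sub_self, mul_zero]

theorem Straight.closureZigzags (hF : F.Straight) (b : Fin n) : F.closureZigzags b = 0 := by
  simp [ArrowTangle.closureZigzags, hF.closureSum]

theorem Straight.glueZigzags (hF : F.Straight) (hF' : F'.Straight) (b : Fin n) :
    F.glueZigzags F' b = 0 := by
  simp [ArrowTangle.glueZigzags, hF.glueSum hF', FlatTangle.glueCycleLength,
    Function.iterate_minimalPeriod]

theorem Straight.concat (hF : F.Straight) (hF' : F'.Straight) : (F.concat F').Straight := by
  refine straight_of_label fun v hv => ?_
  change (if Vtx.Before v ((F.toFlatTangle.concat F'.toFlatTangle).partner v) then F.arcSum F' v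
    else F.arcSum F' ((F.toFlatTangle.concat F'.toFlatTangle).partner v)) = _
  refine (if_pos hv).trans ?_
  -- The last step of the walk also crosses to the opposite point after reaching the exit, but this
  -- does not change the column.
  rw [arcSum, hF.glueSum hF', Function.iterate_succ_apply']
  rfl

end ArrowTangle

/-! ### Associativity, unit and Temperley–Lieb relations in `VTL` -/

namespace VTL

variable {n : ℕ}

theorem smul_mul' (r : Rf) (x y : VTL n) : (r • x) * y = r • (x * y) := by
  change mulMap (r • x) y = r • mulMap x y
  rw [map_smul, LinearMap.smul_apply]

theorem mul_smul' (r : Rf) (x y : VTL n) : x * (r • y) = r • (x * y) :=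
  (mulMap x).map_smul r y

theorem of_mul_of (E E' : FlatTangle n) :
    of E * of E' = loopValue ^ #(E.glueCycles E') • of (E.concat E') := by
  have h : mulMap (of E) = Finsupp.linearCombination (M := VTL n) Rf fun E' : FlatTangle n =>
      loopValue ^ #(E.glueCycles E') • of (E.concat E') :=
    (Finsupp.linearCombination_single _ _ _).trans (one_smul _ _)
  change mulMap (of E) (of E') = _
  rw [h]
  exact (Finsupp.linearCombination_single _ _ _).trans (one_smul _ _)

@[elab_as_elim]
theorem induction {P : VTL n → Prop} (hof : ∀ E, P (of E))
    (hadd : ∀ x y, P x → P y → P (x + y)) (hsmul : ∀ (r : Rf) x, P x → P (r • x))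
    (x : VTL n) : P x := by
  refine Finsupp.induction_linear (motive := P) x ?_ hadd fun E r => ?_
  · have h := hsmul 0 _ (hof (FlatTangle.identity n))
    rwa [zero_smul] at h
  · have h := hsmul r _ (hof E)
    rwa [show r • of E = Finsupp.single E r from
      (Finsupp.smul_single _ _ _).trans (by simp)] at h

/-- Transports an identity at loop value 2 back to loop value z; it is valid for single tangles with
a power as coefficient. -/
theorem pow_smul_of_eq {E E' : FlatTangle n} {a b : ℕ}
    (h : 2 ^ a • E.transfer = 2 ^ b • E'.transfer) :
    loopValue ^ a • of E = loopValue ^ b • of E' := by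
  obtain ⟨rfl, rfl⟩ := FlatTangle.pow_smul_transfer_inj h
  rfl

theorem of_mul_of_eq {E E' X : FlatTangle n} {a : ℕ}
    (h : E.transfer * E'.transfer = 2 ^ a • X.transfer) :
    of E * of E' = loopValue ^ a • of X := by
  rw [of_mul_of]
  exact pow_smul_of_eq (by rw [← FlatTangle.transfer_mul, h])

theorem mul_assoc' (x y z : VTL n) : x * y * z = x * (y * z) := by
  induction x using VTL.induction with
  | hadd a b ha hb => simp only [add_mul, ha, hb]
  | hsmul r a ha => simp only [smul_mul', ha]
  | hof E =>
  induction y using VTL.induction with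
  | hadd a b ha hb => simp only [add_mul, mul_add, ha, hb]
  | hsmul r a ha => simp only [smul_mul', mul_smul', ha]
  | hof E' =>
  induction z using VTL.induction with
  | hadd a b ha hb => simp only [mul_add, ha, hb]
  | hsmul r a ha => simp only [mul_smul', ha]
  | hof E'' =>
  simp only [of_mul_of, smul_mul', mul_smul', smul_smul, ← pow_add]
  -- Both bracketings are now a power of z times one tangle, and both correspond to the same triple
  -- product of matrices.
  refine pow_smul_of_eq ?_
  simp only [pow_add, mul_smul, ← FlatTangle.transfer_mul]
  rw [← Matrix.smul_mul, ← Matrix.mul_smul, ← FlatTangle.transfer_mul, ← FlatTangle.transfer_mul,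
    Matrix.mul_assoc]

theorem one_mul' (x : VTL n) : 1 * x = x := by
  induction x using VTL.induction with
  | hadd a b ha hb => rw [mul_add, ha, hb]
  | hsmul r a ha => rw [mul_smul', ha]
  | hof E =>
  have h := of_mul_of_eq (E := FlatTangle.identity n) (E' := E) (X := E) (a := 0)
    (by rw [FlatTangle.transfer_identity, one_mul, pow_zero, one_smul])
  rwa [pow_zero, one_smul] at h

theorem mul_one' (x : VTL n) : x * 1 = x := by
  induction x using VTL.induction with
  | hadd a b ha hb => rw [add_mul, ha, hb]
  | hsmul r a ha => rw [smul_mul', ha]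
  | hof E =>
  have h := of_mul_of_eq (E := E) (E' := FlatTangle.identity n) (X := E) (a := 0)
    (by rw [FlatTangle.transfer_identity, mul_one, pow_zero, one_smul])
  rwa [pow_zero, one_smul] at h

/-- The ring `VTL_n(R^f)`. -/
noncomputable abbrev ring (n : ℕ) : Ring (VTL n) where
  __ := (inferInstance : NonUnitalNonAssocRing (VTL n))
  one := 1
  mul_assoc := mul_assoc'
  one_mul := one_mul'
  mul_one := mul_one'

/-- The `R^f`-algebra `VTL_n(R^f)`. -/
noncomputable abbrev algebra (n : ℕ) : @Algebra Rf (VTL n) _ (ring n).toSemiring :=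
  letI := ring n
  Algebra.ofModule smul_mul' mul_smul'

theorem E_sq (i : Fin (n - 1)) : E i * E i = loopValue • E i := by
  have h := of_mul_of_eq (a := 1) (FlatTangle.transfer_cupCap_sq i)
  rwa [pow_one] at h

theorem E_comm (i j : Fin (n - 1)) (h : (i : ℕ) + 2 ≤ j ∨ (j : ℕ) + 2 ≤ i) :
    E i * E j = E j * E i := by
  have h := FlatTangle.transfer_cupCap_comm i j h
  rw [FlatTangle.transfer_mul (FlatTangle.cupCap j)] at h
  rw [E, E, of_mul_of_eq h, of_mul_of]

theorem E_near (i j : Fin (n - 1)) (h : (i : ℕ) + 1 = j ∨ (j : ℕ) + 1 = i) :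
    E i * E j * E i = E i := by
  have h := FlatTangle.transfer_cupCap_near i j h
  rw [E, E, of_mul_of, smul_mul', of_mul_of, smul_smul, ← pow_add]
  rw [← one_smul Rf (of (FlatTangle.cupCap i)), ← pow_zero loopValue]
  refine pow_smul_of_eq ?_
  rw [pow_add, mul_smul, ← FlatTangle.transfer_mul, ← Matrix.smul_mul, ← FlatTangle.transfer_mul, h,
    pow_zero, one_smul]

end VTL

/-! ### The homomorphism from the Temperley–Lieb algebra to `VTL` -/

namespace TL

variable {n : ℕ}

@[elab_as_elim]
theorem induction {P : TL n → Prop} (hone : P 1) (hE : ∀ i, P (TL.E i))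
    (hadd : ∀ x y, P x → P y → P (x + y)) (hmul : ∀ x y, P x → P y → P (x * y))
    (hsmul : ∀ (r : Rf) x, P x → P (r • x)) (x : TL n) : P x := by
  obtain ⟨y, rfl⟩ := RingQuot.mkAlgHom_surjective Rf (TLRel n) x
  refine FreeAlgebra.induction Rf (Fin (n - 1))
    (motive := fun y => P (RingQuot.mkAlgHom Rf (TLRel n) y)) (fun r => ?_) hE ?_ ?_ y
  · rw [AlgHom.commutes, Algebra.algebraMap_eq_smul_one]
    exact hsmul r 1 hone
  · intro a b ha hb
    rw [map_mul]
    exact hmul _ _ ha hb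
  · intro a b ha hb
    rw [map_add]
    exact hadd _ _ ha hb

/-- Only the source has to be generated by the unit and the E_i; the target may be non-associative,
as needed for `ATL`. -/
theorem hom_unique {M : Type*} [NonUnitalNonAssocSemiring M] [Module Rf M] {φ ψ : TL n →ₙₐ[Rf] M}
    (hone : φ 1 = ψ 1) (hE : ∀ i, φ (TL.E i) = ψ (TL.E i)) : φ = ψ := by
  ext x
  induction x using TL.induction with
  | hone => exact hone
  | hE i => exact hE i
  | hadd a b ha hb => rw [map_add, map_add, ha, hb]
  | hmul a b ha hb => rw [map_mul, map_mul, ha, hb]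
  | hsmul r a ha => rw [map_smul, map_smul, ha]

section

attribute [local instance] VTL.ring VTL.algebra

/-- The homomorphism to `VTL_n(R^f)` that sends `E_i` to `E_i`. -/
noncomputable def toVTLAlg (n : ℕ) : TL n →ₐ[Rf] VTL n :=
  RingQuot.liftAlgHom Rf ⟨FreeAlgebra.lift Rf VTL.E, by
    intro x y h
    cases h with
    | square i => simp only [map_mul, map_smul, FreeAlgebra.lift_ι_apply, VTL.E_sq]
    | far i j h => simp only [map_mul, FreeAlgebra.lift_ι_apply, VTL.E_comm i j h]
    | near i j h => simp only [map_mul, FreeAlgebra.lift_ι_apply, VTL.E_near i j h]⟩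

theorem toVTLAlg_E (i : Fin (n - 1)) : toVTLAlg n (TL.E i) = VTL.E i := by
  rw [toVTLAlg, TL.E, RingQuot.liftAlgHom_mkAlgHom_apply, FreeAlgebra.lift_ι_apply]

theorem toVTLAlg_one : toVTLAlg n 1 = 1 := map_one _

theorem toVTLAlg_smul (r : Rf) (x : TL n) : toVTLAlg n (r • x) = r • toVTLAlg n x := map_smul _ r x

end

/-- See `toVTLAlg`. -/
noncomputable def toVTL (n : ℕ) : TL n →ₙₐ[Rf] VTL n where
  toFun := toVTLAlg n
  map_smul' := toVTLAlg_smul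
  map_zero' := map_zero (toVTLAlg n)
  map_add' := map_add (toVTLAlg n)
  map_mul' := map_mul (toVTLAlg n)

theorem toVTL_one : toVTL n 1 = 1 := toVTLAlg_one

theorem toVTL_E (i : Fin (n - 1)) : toVTL n (TL.E i) = VTL.E i := toVTLAlg_E i

end TL

/-! ### Products and traces of straight arrow flat tangles -/

namespace ATL

variable {n : ℕ}

noncomputable instance : IsScalarTower Rf Ra (ATL n) :=
  inferInstanceAs (IsScalarTower Rf Ra (ArrowTangle n →₀ Ra))

theorem smul_eq_algebraMap_smul (r : Rf) (x : ATL n) : r • x = algebraMap Rf Ra r • x :=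
  (algebraMap_smul Ra r x).symm

theorem smul_mul' (r : Rf) (x y : ATL n) : (r • x) * y = r • (x * y) := by
  rw [smul_eq_algebraMap_smul, smul_eq_algebraMap_smul]
  change mulMap (algebraMap Rf Ra r • x) y = algebraMap Rf Ra r • mulMap x y
  rw [map_smul, LinearMap.smul_apply]

theorem mul_smul' (r : Rf) (x y : ATL n) : x * (r • y) = r • (x * y) := by
  rw [smul_eq_algebraMap_smul, smul_eq_algebraMap_smul]
  exact (mulMap x).map_smul _ y

theorem of_mul_of (F F' : ArrowTangle n) : of F * of F' =
    (∏ b ∈ F.toFlatTangle.glueCycles F'.toFlatTangle, arrowVar (F.glueZigzags F' b)) •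
      of (F.concat F') := by
  have h : mulMap (of F) = Finsupp.linearCombination (M := ATL n) Ra fun F' : ArrowTangle n =>
      (∏ b ∈ F.toFlatTangle.glueCycles F'.toFlatTangle, arrowVar (F.glueZigzags F' b)) •
        of (F.concat F') :=
    (Finsupp.linearCombination_single _ _ _).trans (one_smul _ _)
  change mulMap (of F) (of F') = _
  rw [h]
  exact (Finsupp.linearCombination_single _ _ _).trans (one_smul _ _)

/-- All closed curves have zero zigzags, so only z₀ occurs and the coefficient comes from `Rf`, as
for the underlying flat tangles. -/
theorem of_mul_of_straight {F F' : ArrowTangle n} (hF : F.Straight) (hF' : F'.Straight) :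
    of F * of F' = loopValue ^ #(F.toFlatTangle.glueCycles F'.toFlatTangle) • of (F.concat F') := by
  rw [of_mul_of, smul_eq_algebraMap_smul]
  simp only [hF.glueZigzags hF', prod_const, map_pow]
  rfl

theorem trace_of_straight {F : ArrowTangle n} (hF : F.Straight) :
    trace n (of F) = algebraMap Rf Ra (VTL.trace n (VTL.of F.toFlatTangle)) := by
  have h1 : trace n (of F) = ∏ b ∈ F.toFlatTangle.closureCycles, arrowVar (F.closureZigzags b) :=
    (Finsupp.linearCombination_single _ _ _).trans (one_smul _ _)
  have h2 : VTL.trace n (VTL.of F.toFlatTangle) = loopValue ^ #F.toFlatTangle.closureCycles :=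
    (Finsupp.linearCombination_single _ _ _).trans (one_smul _ _)
  rw [h1, h2, map_pow]
  simp only [hF.closureZigzags, prod_const]
  rfl

end ATL

/-! ### Lifting flat tangles to straight arrow flat tangles -/

namespace VTL

variable {n : ℕ}

/-- The span of the flat tangles that underlie straight arrow flat tangles. -/
noncomputable def straightSpan (n : ℕ) : Submodule Rf (VTL n) :=
  Submodule.span Rf {x | ∃ F : ArrowTangle n, F.Straight ∧ x = of F.toFlatTangle}

theorem of_mem_straightSpan {F : ArrowTangle n} (hF : F.Straight) :
    of F.toFlatTangle ∈ straightSpan n := Submodule.subset_span ⟨F, hF, rfl⟩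

open Classical in
/-- The linear map that equips a flat tangle with the labels of the straight arrow flat tangle that
it underlies, if there is one, and is zero on the other flat tangles. -/
noncomputable def straighten (n : ℕ) : VTL n →ₗ[Rf] ATL n :=
  Finsupp.linearCombination (M := ATL n) Rf fun E : FlatTangle n =>
    if h : ∃ F : ArrowTangle n, F.Straight ∧ F.toFlatTangle = E then ATL.of h.choose else 0

theorem straighten_of {F : ArrowTangle n} (hF : F.Straight) :
    straighten n (of F.toFlatTangle) = ATL.of F := by
  have h : ∃ G : ArrowTangle n, G.Straight ∧ G.toFlatTangle = F.toFlatTangle := ⟨F, hF, rfl⟩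
  have h1 : straighten n (of F.toFlatTangle) = ATL.of h.choose :=
    (Finsupp.linearCombination_single _ _ _).trans ((one_smul _ _).trans (dif_pos h))
  rw [h1, h.choose_spec.1.ext hF h.choose_spec.2]

/-- On basis elements both products have the same power of z, and the concatenation of the straight
lifts is the straight lift of the concatenation. Bilinearity gives the rest. -/
theorem straighten_mul {x y : VTL n} (hx : x ∈ straightSpan n) (hy : y ∈ straightSpan n) :
    x * y ∈ straightSpan n ∧ straighten n (x * y) = straighten n x * straighten n y := by
  induction hx, hy using Submodule.span_induction₂ with
  | mem_mem x y hx hy =>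
    obtain ⟨F, hF, rfl⟩ := hx
    obtain ⟨F', hF', rfl⟩ := hy
    have hc : of F.toFlatTangle * of F'.toFlatTangle =
        loopValue ^ #(F.toFlatTangle.glueCycles F'.toFlatTangle) •
          of (F.concat F').toFlatTangle := of_mul_of _ _
    rw [hc, map_smul, straighten_of (hF.concat hF'), straighten_of hF, straighten_of hF',
      ATL.of_mul_of_straight hF hF']
    exact ⟨Submodule.smul_mem _ _ (of_mem_straightSpan (hF.concat hF')), rfl⟩
  | zero_left y _ => simp
  | zero_right x _ => simp
  | add_left x y z _ _ _ h1 h2 =>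
    rw [add_mul, map_add, map_add, add_mul, h1.2, h2.2]
    exact ⟨add_mem h1.1 h2.1, rfl⟩
  | add_right x y z _ _ _ h1 h2 =>
    rw [mul_add, map_add, map_add, mul_add, h1.2, h2.2]
    exact ⟨add_mem h1.1 h2.1, rfl⟩
  | smul_left r x y _ _ h =>
    rw [smul_mul', map_smul, map_smul, ATL.smul_mul', h.2]
    exact ⟨Submodule.smul_mem _ _ h.1, rfl⟩
  | smul_right r x y _ _ h =>
    rw [mul_smul', map_smul, map_smul, ATL.mul_smul', h.2]
    exact ⟨Submodule.smul_mem _ _ h.1, rfl⟩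

theorem trace_straighten {x : VTL n} (hx : x ∈ straightSpan n) :
    ATL.trace n (straighten n x) = algebraMap Rf Ra (trace n x) := by
  induction hx using Submodule.span_induction with
  | mem x hx =>
    obtain ⟨F, hF, rfl⟩ := hx
    rw [straighten_of hF, ATL.trace_of_straight hF]
  | zero => simp
  | add x y _ _ h1 h2 => rw [map_add, map_add, map_add, map_add, h1, h2]
  | smul r x _ h =>
    rw [LinearMap.map_smul, LinearMap.map_smul, ATL.smul_eq_algebraMap_smul, LinearMap.map_smul, h,
      smul_eq_mul, smul_eq_mul, map_mul]

end VTL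

/-! ### The homomorphism to `ATL` and the comparison of traces -/

namespace TL

variable {n : ℕ}

/-- The span contains the images of the generators and is closed under products. This makes
`straighten` multiplicative on the whole image. -/
theorem toVTL_mem_straightSpan (x : TL n) : toVTL n x ∈ VTL.straightSpan n := by
  induction x using TL.induction with
  | hone =>
    rw [toVTL_one]
    exact VTL.of_mem_straightSpan ArrowTangle.straight_identity
  | hE i =>
    rw [toVTL_E]
    exact VTL.of_mem_straightSpan (ArrowTangle.straight_cupCap i)
  | hadd a b ha hb =>
    rw [map_add]
    exact add_mem ha hb
  | hmul a b ha hb =>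
    rw [map_mul]
    exact (VTL.straighten_mul ha hb).1
  | hsmul r a ha =>
    rw [map_smul]
    exact Submodule.smul_mem _ _ ha

/-- The homomorphism to `ATL_n(R^a)` that sends `E_i` to `F_i`. -/
noncomputable def toATL (n : ℕ) : TL n →ₙₐ[Rf] ATL n where
  toFun x := VTL.straighten n (toVTL n x)
  map_smul' r x := by rw [map_smul, map_smul]; rfl
  map_zero' := by rw [map_zero, map_zero]
  map_add' x y := by rw [map_add, map_add]
  map_mul' x y := by
    rw [map_mul, (VTL.straighten_mul (toVTL_mem_straightSpan x) (toVTL_mem_straightSpan y)).2]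

theorem toATL_one : toATL n 1 = 1 := by
  change VTL.straighten n (toVTL n 1) = 1
  rw [toVTL_one]
  exact VTL.straighten_of (F := ArrowTangle.identity n) ArrowTangle.straight_identity

theorem toATL_E (i : Fin (n - 1)) : toATL n (TL.E i) = ATL.F i := by
  change VTL.straighten n (toVTL n (TL.E i)) = ATL.F i
  rw [toVTL_E]
  exact VTL.straighten_of (F := ArrowTangle.cupCap i) (ArrowTangle.straight_cupCap i)

end TL

theorem proposition3p7 (n : ℕ) (hn : 1 ≤ n) :
    (∃! ε : TL n →ₙₐ[Rf] VTL n, ε 1 = 1 ∧ ∀ i, ε (TL.E i) = VTL.E i) ∧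
    (∃! ι : TL n →ₙₐ[Rf] ATL n, ι 1 = 1 ∧ ∀ i, ι (TL.E i) = ATL.F i) ∧
    ∀ (ε : TL n →ₙₐ[Rf] VTL n) (ι : TL n →ₙₐ[Rf] ATL n),
      (ε 1 = 1 ∧ ∀ i, ε (TL.E i) = VTL.E i) →
      (ι 1 = 1 ∧ ∀ i, ι (TL.E i) = ATL.F i) →
      ∀ x : TL n, ATL.trace n (ι x) = algebraMap Rf Ra (VTL.trace n (ε x)) := by
  have hε : ∀ ε : TL n →ₙₐ[Rf] VTL n, (ε 1 = 1 ∧ ∀ i, ε (TL.E i) = VTL.E i) → ε = TL.toVTL n :=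
    fun ε h => TL.hom_unique (h.1.trans TL.toVTL_one.symm) fun i =>
      (h.2 i).trans (TL.toVTL_E i).symm
  have hι : ∀ ι : TL n →ₙₐ[Rf] ATL n, (ι 1 = 1 ∧ ∀ i, ι (TL.E i) = ATL.F i) → ι = TL.toATL n :=
    fun ι h => TL.hom_unique (h.1.trans TL.toATL_one.symm) fun i =>
      (h.2 i).trans (TL.toATL_E i).symm
  refine ⟨⟨TL.toVTL n, ⟨TL.toVTL_one, TL.toVTL_E⟩, hε⟩, ⟨TL.toATL n, ⟨TL.toATL_one, TL.toATL_E⟩, hι⟩,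
    fun ε ι h1 h2 x => ?_⟩
  rw [hε ε h1, hι ι h2]
  exact VTL.trace_straighten (TL.toVTL_mem_straightSpan x)
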